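/- Let $X_1, X_2, \dots$ be independent and identically distributed real random variables on a probability space $(\Omega,\mathcal F,\mathsf P)$ with $\mathsf E|X_1|<\infty$ and $\mathsf E[X_1]=0$, and let $S_k := \sum_{i=1}^k X_i$. Let $\bar\sigma\in(0,\infty)$ and assume that $X_1$ has finite variance $\sigma^2 := \mathrm{Var}[X_1] \le \bar\sigma^2$. For $x\ge 0$ put $$\bar{\mathsf U}^{(2)}(x) := \mathsf E\left[\,|X_1^2-\sigma^2|\,\mathbf 1\{|X_1^2-\sigma^2|\ge x\}\right].$$ For $\varepsilon>0$ put $$c_\varepsilon := \frac{(1+\varepsilon)^{5/4}+(1+\varepsilon)^{3/4}}{\sqrt2},\qquad \ell_\varepsilon := \log\left(\frac{2\zeta(1+\varepsilon)}{\log(1+\varepsilon)}\right),$$ where $\zeta(z)=\sum_{j=1}^\infty j^{-z}$, $z>1$, is the Riemann zeta function. Then for all $\varepsilon>0$, $\lambda\in(0,1/2)$ and every integer $m\ge 2$, $$\mathsf P\left[\sup_{k\ge m}\frac{|S_k/\bar\sigma|}{c_\varepsilon\sqrt{k\left(\log\log((1+\varepsilon)^2k)+\ell_\varepsilon\right)}}\ge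 1\right]\le \frac{\left(\log_{1+\varepsilon}(2m/3)\right)^{-\varepsilon}}{\varepsilon\,\zeta(1+\varepsilon)}+\frac{262}{\min(\varepsilon^2\bar\sigma^4,\,1)}\left(m^{2\lambda-1}+\bar{\mathsf U}^{(2)}(m^\lambda)\right).$$ -/

import Mathlib

open MeasureTheory ProbabilityTheory

namespace LILInequality

noncomputable section

/-- The Riemann zeta function at a real argument `s > 1`: `ζ(s) = ∑_{j ≥ 1} j^{-s}`. -/
def zeta (s : ℝ) : ℝ := ∑' j : ℕ, ((j : ℝ) + 1) ^ (-s)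

/-- For real `s > 1`, `zeta s` is the value at `s` of Mathlib's Riemann zeta function. -/
theorem ofReal_zeta {s : ℝ} (hs : 1 < s) : ((zeta s : ℝ) : ℂ) = riemannZeta (s : ℂ) := by
  rw [zeta_eq_tsum_one_div_nat_add_one_cpow (by simpa using hs), zeta, Complex.ofReal_tsum]
  refine tsum_congr fun j => ?_
  have hj : (0 : ℝ) ≤ (j : ℝ) + 1 := by positivity
  rw [Complex.ofReal_cpow hj]
  push_cast
  rw [Complex.cpow_neg, one_div]

/-- `c_ε = ((1+ε)^{5/4} + (1+ε)^{3/4}) / √2`. -/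
def cConst (ε : ℝ) : ℝ :=
  ((1 + ε) ^ (5 / 4 : ℝ) + (1 + ε) ^ (3 / 4 : ℝ)) / Real.sqrt 2

/-- `ℓ_ε = log (2 ζ(1+ε) / log (1+ε))`. -/
def lConst (ε : ℝ) : ℝ :=
  Real.log (2 * zeta (1 + ε) / Real.log (1 + ε))

variable {Ω : Type*}

/-- The partial sum of the first `k` variables; the sequence is indexed from `0`, so that
`X 0, X 1, …` are `X_1, X_2, …` in the usual numbering. -/
def partialSum (X : ℕ → Ω → ℝ) (k : ℕ) (ω : Ω) : ℝ :=
  ∑ i ∈ Finset.range k, X i ω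

/-- The truncated first absolute moment `E[|Y² - σ²| 1{|Y² - σ²| ≥ x}]`, where `σ² = Var Y`. -/
def truncMoment [MeasurableSpace Ω] (P : Measure Ω) (Y : Ω → ℝ) (x : ℝ) : ℝ :=
  ∫ ω, Set.indicator {ω' | x ≤ |Y ω' ^ 2 - variance Y P|}
    (fun ω' => |Y ω' ^ 2 - variance Y P|) ω ∂P

end

end LILInequality

/-!
Put `ξ i = X i / σ` and `V k = ∑ i < k, (ξ i ^ 2 + 2) / 3`. Because
`exp (x - x ^ 2 / 6) ≤ 1 + x + x ^ 2 / 3`, the process `exp (θ * ∑ i < k, ξ i - θ ^ 2 * V k / 2)`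
is dominated by a product of independent variables of mean at most one, with no exponential moment
of `X 0` needed, so Ville's inequality bounds the probability that the sums ever cross a line in
`V k`. Spending the error probability `1 / c_j` with `c_j = 2 ζ(1 + ε) (log_{1+ε} w + j + 1)^{1+ε}`
on the epoch `w (1 + ε) ^ j ≤ V k ≤ w (1 + ε) ^ (j + 1)` stitches these lines together below the
boundary, as long as `V k ≤ (1 + ε) k`. That last condition fails only if the sums of the centred
squares `X i ^ 2 - Var (X 0)` are at least `3 ε σ ^ 2 k`, which a quantitative strong law of large
numbers controls. Finally, a supremum over `k` may equal one without being attained; but the same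
bound for the strictly lower boundary with `ε / 2` shows that almost surely the ratios are
eventually bounded away from one.
-/

namespace LILInequality

open Filter Finset

section MaximalInequalities

variable {Ω : Type*} [mΩ : MeasurableSpace Ω] {μ : Measure Ω} {f : ℕ → Ω → ℝ}

theorem measure_exists_le_of_submartingale [IsFiniteMeasure μ] {𝒢 : Filtration ℕ mΩ}
    (hf : Submartingale f 𝒢 μ) (hnonneg : 0 ≤ f) {c C : ℝ} (hc : 0 < c)
    (hC : ∀ n, ∫ ω, f n ω ∂μ ≤ C) :
    μ {ω | ∃ n, c ≤ f n ω} ≤ ENNReal.ofReal (C / c) := by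
  have hunion : {ω | ∃ n, c ≤ f n ω} = ⋃ n : ℕ, {ω | ∃ k ≤ n, c ≤ f k ω} := by
    ext ω
    simp only [Set.mem_ofPred_eq, Set.mem_iUnion]
    exact ⟨fun ⟨n, hn⟩ => ⟨n, n, le_rfl, hn⟩, fun ⟨_, k, _, hk⟩ => ⟨k, hk⟩⟩
  have hmono : Monotone fun n : ℕ => {ω | ∃ k ≤ n, c ≤ f k ω} :=
    fun _ _ hab _ ⟨k, hk, h⟩ => ⟨k, hk.trans hab, h⟩
  rw [hunion, hmono.measure_iUnion]
  refine iSup_le fun n => ?_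
  lift c to NNReal using hc.le
  have hsup : {ω | (c : ℝ) ≤ (range (n + 1)).sup' nonempty_range_add_one fun k => f k ω}
      = {ω | ∃ k ≤ n, (c : ℝ) ≤ f k ω} := by
    ext ω
    simp [le_sup'_iff]
  have hdoob := maximal_ineq hf hnonneg (ε := c) n
  rw [hsup] at hdoob
  have hset : ∫ ω in {ω | ∃ k ≤ n, (c : ℝ) ≤ f k ω}, f n ω ∂μ ≤ C :=
    (setIntegral_le_integral (hf.integrable n) (.of_forall (hnonneg n))).trans (hC n)
  rw [ENNReal.ofReal_div_of_pos hc, ENNReal.ofReal_coe_nnreal,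
    ENNReal.le_div_iff_mul_le (Or.inl (by exact_mod_cast hc.ne')) (by simp), mul_comm]
  exact hdoob.trans (ENNReal.ofReal_le_ofReal hset)

theorem submartingale_sq_of_martingale [IsFiniteMeasure μ] {𝒢 : Filtration ℕ mΩ}
    (hf : Martingale f 𝒢 μ) (hL2 : ∀ n, MemLp (f n) 2 μ) :
    Submartingale (fun n ω => f n ω ^ 2) 𝒢 μ := by
  refine submartingale_nat (fun n => (hf.stronglyAdapted n).pow 2)
    (fun n => (hL2 n).integrable_sq) fun n => ?_
  have hjensen := (even_two.convexOn_pow (𝕜 := ℝ)).map_condExp_le_univ (𝒢.le n)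
    (continuous_pow 2).lowerSemicontinuous (hf.integrable (n + 1)) (hL2 (n + 1)).integrable_sq
  filter_upwards [hjensen, hf.condExp_ae_eq n.le_succ] with ω hω hmart
  rw [← hmart]
  exact hω

theorem martingale_sum_range_succ (hf : ∀ i, StronglyMeasurable (f i)) (hind : iIndepFun f μ)
    (hint : ∀ i, Integrable (f i) μ) (hmean : ∀ i, ∫ ω, f i ω ∂μ = 0) :
    Martingale (fun n ω => ∑ i ∈ range (n + 1), f i ω) (Filtration.natural f hf) μ := by
  have : IsProbabilityMeasure μ := hind.isProbabilityMeasure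
  refine martingale_of_condExp_sub_eq_zero_nat (fun n => ?_)
    (fun n => integrable_finsetSum _ fun i _ => hint i) fun n => ?_
  · exact stronglyMeasurable_fun_sum _ fun i hi =>
      (Filtration.stronglyAdapted_natural hf).stronglyMeasurable_le (mem_range_succ_iff.1 hi)
  · have hdiff : ((fun ω => ∑ i ∈ range (n + 1 + 1), f i ω) -
        fun ω => ∑ i ∈ range (n + 1), f i ω) = f (n + 1) := by
      ext ω
      simp [sum_range_succ]
    rw [hdiff]
    filter_upwards [hind.condExp_natural_ae_eq_of_lt hf n.lt_succ_self] with ω hω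
    rw [hω, hmean, Pi.zero_apply]

theorem integrable_prod_range (hmeas : ∀ i, Measurable (f i)) (hind : iIndepFun f μ)
    (hint : ∀ i, Integrable (f i) μ) (n : ℕ) :
    Integrable (fun ω => ∏ i ∈ range n, f i ω) μ := by
  have : IsProbabilityMeasure μ := hind.isProbabilityMeasure
  induction n with
  | zero => simp
  | succ n ih =>
    simp_rw [prod_range_succ]
    have hindep := hind.indepFun_prod_range_succ hmeas n
    rw [show ∏ i ∈ range n, f i = fun ω => ∏ i ∈ range n, f i ω by ext ω; simp] at hindep
    exact hindep.integrable_mul ih (hint n)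

theorem martingale_prod_range_succ (hf : ∀ i, StronglyMeasurable (f i)) (hind : iIndepFun f μ)
    (hint : ∀ i, Integrable (f i) μ) (hmean : ∀ i, ∫ ω, f i ω ∂μ = 1) :
    Martingale (fun n ω => ∏ i ∈ range (n + 1), f i ω) (Filtration.natural f hf) μ := by
  have : IsProbabilityMeasure μ := hind.isProbabilityMeasure
  have hprod (n) := integrable_prod_range (fun i => (hf i).measurable) hind hint n
  have hadapted : StronglyAdapted (Filtration.natural f hf)
      fun n ω => ∏ i ∈ range (n + 1), f i ω := fun n =>
    stronglyMeasurable_fun_prod _ fun i hi =>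
      (Filtration.stronglyAdapted_natural hf).stronglyMeasurable_le (mem_range_succ_iff.1 hi)
  refine martingale_nat hadapted (fun n => hprod (n + 1)) fun n => ?_
  have hsucc : (fun ω => ∏ i ∈ range (n + 1 + 1), f i ω) =
      (fun ω => ∏ i ∈ range (n + 1), f i ω) * f (n + 1) := by
    ext ω
    simp [prod_range_succ]
  have hpull := condExp_mul_of_stronglyMeasurable_left (μ := μ) (hadapted n)
    (hsucc ▸ hprod (n + 2)) (hint (n + 1))
  rw [hsucc]
  filter_upwards [hind.condExp_natural_ae_eq_of_lt hf n.lt_succ_self, hpull] with ω hω hpullω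
  rw [hpullω, Pi.mul_apply, hω, hmean, mul_one]

theorem measure_exists_le_prod_range (hmeas : ∀ i, Measurable (f i)) (hind : iIndepFun f μ)
    (hint : ∀ i, Integrable (f i) μ) (hnonneg : ∀ i ω, 0 ≤ f i ω)
    (hmean : ∀ i, ∫ ω, f i ω ∂μ ≤ 1) {c : ℝ} (hc : 0 < c) :
    μ {ω | ∃ n, c ≤ ∏ i ∈ range n, f i ω} ≤ ENNReal.ofReal (1 / c) := by
  have : IsProbabilityMeasure μ := hind.isProbabilityMeasure
  rcases le_or_gt c 1 with hc1 | hc1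
  · exact prob_le_one.trans (ENNReal.one_le_ofReal.2 ((one_le_div hc).2 hc1))
  -- Adding constants makes every mean equal to `1`, and only enlarges the products.
  set g : ℕ → Ω → ℝ := fun i ω => f i ω + (1 - ∫ ω, f i ω ∂μ) with hg
  have hgmeas (i) : Measurable (g i) := (hmeas i).add_const _
  have hfg (i ω) : f i ω ≤ g i ω := le_add_of_nonneg_right (sub_nonneg.2 (hmean i))
  have hgind : iIndepFun g μ :=
    hind.comp (fun i y => y + (1 - ∫ ω, f i ω ∂μ)) fun _ => measurable_id.add_const _
  have hgmean (i) : ∫ ω, g i ω ∂μ = 1 := by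
    rw [hg, integral_add (hint i) (integrable_const _)]
    simp
  have hmart := martingale_prod_range_succ (fun i => (hgmeas i).stronglyMeasurable) hgind
    (fun i => (hint i).add (integrable_const _)) hgmean
  refine (measure_mono ?_).trans (measure_exists_le_of_submartingale hmart.submartingale
    (fun n ω => prod_nonneg fun i _ => (hnonneg i ω).trans (hfg i ω)) hc fun n => ?_)
  · rintro ω ⟨_ | n, hn⟩
    · exact absurd (by simpa using hn) hc1.not_ge
    · exact ⟨n, hn.trans (prod_le_prod (fun i _ => hnonneg i ω) fun i _ => hfg i ω)⟩
  · have hconst := hmart.setIntegral_eq n.zero_le MeasurableSet.univ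
    simp only [setIntegral_univ] at hconst
    rw [← hconst]
    simp [hgmean]

theorem measure_exists_le_abs_sum_range_sub_integral (hmeas : ∀ i, Measurable (f i))
    (hind : iIndepFun f μ) (hL2 : ∀ i, MemLp (f i) 2 μ) {b C : ℝ} (hb : 0 < b)
    (hC : ∀ n, ∑ i ∈ range n, Var[f i; μ] ≤ C) :
    μ {ω | ∃ n, b ≤ |∑ i ∈ range n, (f i ω - ∫ ω', f i ω' ∂μ)|}
      ≤ ENNReal.ofReal (C / b ^ 2) := by
  have : IsProbabilityMeasure μ := hind.isProbabilityMeasure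
  have hint (i) : Integrable (f i) μ := (hL2 i).integrable one_le_two
  have hsumL2 (n) : MemLp (fun ω => ∑ i ∈ range n, (f i ω - ∫ ω', f i ω' ∂μ)) 2 μ :=
    memLp_finsetSum _ fun i _ => (hL2 i).sub (memLp_const _)
  have hmart := martingale_sum_range_succ
    (fun i => ((hmeas i).sub_const (∫ ω', f i ω' ∂μ)).stronglyMeasurable)
    (hind.comp (fun i y => y - ∫ ω', f i ω' ∂μ) fun _ => measurable_id.sub_const _)
    (fun i => (hint i).sub (integrable_const _)) fun i => by
      rw [integral_sub (hint i) (integrable_const _)]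
      simp
  have hvar (n) : ∫ ω, (∑ i ∈ range n, (f i ω - ∫ ω', f i ω' ∂μ)) ^ 2 ∂μ ≤ C := by
    refine le_trans (le_of_eq ?_) (hC n)
    rw [← IndepFun.variance_sum (fun i _ => hL2 i) fun i _ j _ hij => hind.indepFun hij,
      variance_eq_integral (Finset.aemeasurable_sum _ fun i _ => (hmeas i).aemeasurable)]
    simp only [Finset.sum_apply, sum_sub_distrib, integral_finsetSum _ fun i _ => hint i]
  refine (measure_mono ?_).trans (measure_exists_le_of_submartingale
    (submartingale_sq_of_martingale hmart fun n => hsumL2 (n + 1)) (fun n ω => sq_nonneg _)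
    (pow_pos hb 2) fun n => hvar (n + 1))
  rintro ω ⟨_ | n, hn⟩
  · exact absurd (by simpa using hn) hb.not_ge
  · exact ⟨n, by simpa only [sq_abs] using pow_le_pow_left₀ hb.le hn 2⟩

end MaximalInequalities

/-- `|z|` cut to zero below the level `x`, so that `truncMoment P Y x` is the mean of
`absTail x (Y ^ 2 - Var Y)`. -/
noncomputable def absTail (x z : ℝ) : ℝ := {z : ℝ | x ≤ |z|}.indicator (fun z => |z|) z

theorem absTail_of_le {x z : ℝ} (h : x ≤ |z|) : absTail x z = |z| :=
  Set.indicator_of_mem (s := {z : ℝ | x ≤ |z|}) h _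

theorem absTail_of_lt {x z : ℝ} (h : |z| < x) : absTail x z = 0 :=
  Set.indicator_of_notMem (s := {z : ℝ | x ≤ |z|}) h.not_ge _

theorem absTail_nonneg (x z : ℝ) : 0 ≤ absTail x z :=
  Set.indicator_nonneg (fun _ _ => abs_nonneg _) z

theorem absTail_le_abs (x z : ℝ) : absTail x z ≤ |z| :=
  Set.indicator_le_self' (fun _ _ => abs_nonneg _) z

theorem measurable_absTail (x : ℝ) : Measurable (absTail x) :=
  measurable_norm.indicator (measurableSet_le measurable_const measurable_norm)

/-- The level at which the variable with index `i` is truncated: its position `i + 1` in the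
sequence, but at least `m`. -/
def truncLevel (m i : ℕ) : ℕ := max (i + 1) m

theorem truncLevel_pos (m i : ℕ) : 0 < truncLevel m i := by
  simp [truncLevel]

theorem monotone_truncLevel (m : ℕ) : Monotone (truncLevel m) := fun _ _ h =>
  max_le_max_right m (Nat.succ_le_succ h)

theorem sum_inv_sq_truncLevel_le {N : ℕ} (hN : 0 < N) (n : ℕ) :
    ∑ i ∈ range n, ((truncLevel N i : ℝ) ^ 2)⁻¹ ≤ 2 / N := by
  have hN' : (N : ℝ) ≠ 0 := by positivity
  calc ∑ i ∈ range n, ((truncLevel N i : ℝ) ^ 2)⁻¹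
      ≤ ∑ i ∈ range (N + n), ((truncLevel N i : ℝ) ^ 2)⁻¹ :=
        sum_le_sum_of_subset_of_nonneg (range_mono (by lia)) fun _ _ _ => by positivity
    _ = ∑ i ∈ range N, ((N : ℝ) ^ 2)⁻¹ + ∑ i ∈ Ioc N (N + n), ((i : ℝ) ^ 2)⁻¹ := by
        rw [sum_range_add, ← Ico_add_one_add_one_eq_Ioc, sum_Ico_eq_sum_range]
        congr 1
        · exact sum_congr rfl fun i hi => by
            rw [truncLevel, max_eq_right (Nat.succ_le_of_lt (mem_range.1 hi))]
        · rw [show N + n + 1 - (N + 1) = n by lia]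
          exact sum_congr rfl fun i _ => by
            rw [truncLevel, max_eq_left (by lia), Nat.add_right_comm]
    _ ≤ (N : ℝ)⁻¹ + (N : ℝ)⁻¹ := by
        gcongr
        · rw [sum_const, card_range, nsmul_eq_mul, sq, mul_inv, mul_inv_cancel_left₀ hN']
        · exact (sum_Ioc_inv_sq_le_sub hN.ne' (Nat.le_add_right N n)).trans
            (sub_le_self _ (by positivity))
    _ = 2 / N := by ring

theorem abs_sum_range_succ_mul_lt {L a : ℕ → ℝ} (hL : Monotone L) (hpos : 0 < L 0) {b : ℝ}
    (ha : ∀ n, |∑ i ∈ range n, a i| < b) (n : ℕ) :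
    |∑ i ∈ range (n + 1), L i * a i| < 2 * b * L n := by
  have hn : 0 < L n := hpos.trans_le (hL n.zero_le)
  have hb : 0 < b := (abs_nonneg _).trans_lt (ha 0)
  have hparts := sum_range_by_parts L a (n + 1)
  simp only [smul_eq_mul, add_tsub_cancel_right] at hparts
  calc |∑ i ∈ range (n + 1), L i * a i|
      ≤ |L n * ∑ i ∈ range (n + 1), a i| +
          ∑ i ∈ range n, |(L (i + 1) - L i) * ∑ j ∈ range (i + 1), a j| := by
        rw [hparts]
        exact (abs_sub _ _).trans (add_le_add_right (abs_sum_le_sum_abs _ _) _)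
    _ < L n * b + ∑ i ∈ range n, (L (i + 1) - L i) * b := by
        refine add_lt_add_of_lt_of_le ?_ (sum_le_sum fun i _ => ?_)
        · rw [abs_mul, abs_of_pos hn]
          exact mul_lt_mul_of_pos_left (ha _) hn
        · rw [abs_mul, abs_of_nonneg (sub_nonneg.2 (hL i.le_succ))]
          exact mul_le_mul_of_nonneg_left (ha _).le (sub_nonneg.2 (hL i.le_succ))
    _ ≤ 2 * b * L n := by
        rw [← sum_mul, sum_range_sub]
        nlinarith

theorem tsum_indicator_truncLevel_le_abs_le {m : ℕ} {x : ℝ} (hx : x ≤ m) (z : ℝ) :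
    ∑' i : ℕ, {z : ℝ | (truncLevel m i : ℝ) ≤ |z|}.indicator (1 : ℝ → ENNReal) z
      ≤ ENNReal.ofReal (absTail x z) := by
  rcases lt_or_ge |z| m with hz | hz
  · rw [ENNReal.tsum_eq_zero.2 fun i => Set.indicator_of_notMem (fun hi => ?_) _]
    · exact zero_le
    · exact hz.not_ge ((Nat.cast_le.2 (le_max_right _ _)).trans hi)
  rw [absTail_of_le (hx.trans hz), tsum_eq_sum (s := range ⌊|z|⌋₊) fun i hi =>
    Set.indicator_of_notMem (fun hi' => ?_) _]
  · calc ∑ i ∈ range ⌊|z|⌋₊, {z : ℝ | (truncLevel m i : ℝ) ≤ |z|}.indicator 1 z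
        ≤ ∑ i ∈ range ⌊|z|⌋₊, 1 := sum_le_sum fun i _ => Set.indicator_le_self _ _ _
      _ = ENNReal.ofReal ⌊|z|⌋₊ := by simp
      _ ≤ ENNReal.ofReal |z| := ENNReal.ofReal_le_ofReal (Nat.floor_le (abs_nonneg z))
  · have hlevel : i + 1 ≤ ⌊|z|⌋₊ := (le_max_left _ m).trans (Nat.le_floor hi')
    exact hi (mem_range.2 hlevel)

theorem sum_sq_truncation_div_le {Ω : Type*} (Y : Ω → ℝ) {m : ℕ} (hm : 0 < m) (x : ℝ) (n : ℕ)
    (ω : Ω) :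
    ∑ i ∈ range n, (truncation Y (truncLevel m i) ω / truncLevel m i) ^ 2
      ≤ 2 * (x ^ 2 / m + absTail x (Y ω)) := by
  set N := max m ⌈|Y ω|⌉₊
  have hmN : (m : ℝ) ≤ N := Nat.cast_le.2 (le_max_left _ _)
  have hYN : |Y ω| ≤ N := (Nat.le_ceil _).trans (Nat.cast_le.2 (le_max_right _ _))
  have hN : 0 < N := hm.trans_le (le_max_left _ _)
  have hterm (i : ℕ) : (truncation Y (truncLevel m i) ω / truncLevel m i) ^ 2 ≤
      Y ω ^ 2 * ((truncLevel N i : ℝ) ^ 2)⁻¹ := by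
    rcases le_or_gt |Y ω| (truncLevel m i) with hle | hgt
    · have hlevel : truncLevel N i = truncLevel m i := by
        have := Nat.ceil_le.2 hle
        grind [truncLevel]
      rw [hlevel, div_pow, div_eq_mul_inv]
      exact mul_le_mul_of_nonneg_right (sq_le_sq.2 (abs_truncation_le_abs_self _ _ _))
        (by positivity)
    · rw [truncation, Function.comp_apply, Set.indicator_of_notMem fun hmem =>
        hgt.not_ge (abs_le.2 ⟨hmem.1.le, hmem.2⟩), zero_div, zero_pow two_ne_zero]
      positivity
  have hsum : ∑ i ∈ range n, (truncation Y (truncLevel m i) ω / truncLevel m i) ^ 2 ≤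
      2 * (Y ω ^ 2 / N) := by
    calc _ ≤ Y ω ^ 2 * ∑ i ∈ range n, ((truncLevel N i : ℝ) ^ 2)⁻¹ := by
          rw [mul_sum]
          exact sum_le_sum fun i _ => hterm i
      _ ≤ Y ω ^ 2 * (2 / N) := by gcongr; exact sum_inv_sq_truncLevel_le hN n
      _ = 2 * (Y ω ^ 2 / N) := by ring
  refine hsum.trans (mul_le_mul_of_nonneg_left ?_ zero_le_two)
  rw [← sq_abs (Y ω)]
  rcases lt_or_ge |Y ω| x with hlt | hge
  · rw [absTail_of_lt hlt, add_zero]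
    gcongr
  · rw [absTail_of_le hge]
    have hYsq : |Y ω| ^ 2 / N ≤ |Y ω| := by
      rw [div_le_iff₀ (by positivity), sq]
      gcongr
    exact hYsq.trans (le_add_of_nonneg_left (by positivity))

section LargeNumbers

variable {Ω : Type*} [mΩ : MeasurableSpace Ω] {μ : Measure Ω} {Y : Ω → ℝ} {Z : ℕ → Ω → ℝ}

theorem integrable_absTail (hY : Integrable Y μ) (x : ℝ) :
    Integrable (fun ω => absTail x (Y ω)) μ :=
  hY.mono ((measurable_absTail x).comp_aemeasurable hY.aemeasurable).aestronglyMeasurable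
    (.of_forall fun ω => by
      rw [Real.norm_of_nonneg (absTail_nonneg _ _)]
      exact absTail_le_abs _ _)

theorem tendsto_integral_absTail (hY : Integrable Y μ) :
    Tendsto (fun x => ∫ ω, absTail x (Y ω) ∂μ) atTop (nhds 0) := by
  rw [← integral_zero Ω ℝ (μ := μ)]
  refine tendsto_integral_filter_of_dominated_convergence (fun ω => |Y ω|)
    (.of_forall fun x => (integrable_absTail hY x).aestronglyMeasurable)
    (.of_forall fun x => .of_forall fun ω => ?_) hY.abs (.of_forall fun ω => ?_)
  · rw [Real.norm_of_nonneg (absTail_nonneg _ _)]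
    exact absTail_le_abs _ _
  · refine tendsto_const_nhds.congr' ?_
    filter_upwards [eventually_gt_atTop |Y ω|] with x hx using (absTail_of_lt hx).symm

theorem integral_truncation_le [IsFiniteMeasure μ] (hY : Integrable Y μ)
    (hmean : ∫ ω, Y ω ∂μ = 0) {x A : ℝ} (hxA : x ≤ A) :
    ∫ ω, truncation Y A ω ∂μ ≤ ∫ ω, absTail x (Y ω) ∂μ := by
  have htrunc : Integrable (truncation Y A) μ := hY.aestronglyMeasurable.integrable_truncation
  calc ∫ ω, truncation Y A ω ∂μ = ∫ ω, (truncation Y A ω - Y ω) ∂μ := by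
        rw [integral_sub htrunc hY, hmean, sub_zero]
    _ ≤ ∫ ω, absTail x (Y ω) ∂μ := by
        refine integral_mono (htrunc.sub hY) (integrable_absTail hY x) fun ω => ?_
        rcases lt_or_ge |Y ω| A with hlt | hge
        · simp only [truncation_eq_self hlt, sub_self, absTail_nonneg]
        · simp only [absTail_of_le (hxA.trans hge)]
          rw [truncation, Function.comp_apply]
          by_cases hmem : Y ω ∈ Set.Ioc (-A) A
          · simp [Set.indicator_of_mem hmem]
          · rw [Set.indicator_of_notMem hmem, zero_sub]
            exact neg_le_abs _

theorem measure_exists_truncLevel_le_abs_le (hmeas : ∀ i, Measurable (Z i))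
    (hident : ∀ i, IdentDistrib (Z i) (Z 0) μ μ) (hint : Integrable (Z 0) μ) {m : ℕ} {x : ℝ}
    (hx : x ≤ m) :
    μ {ω | ∃ i, truncLevel m i ≤ |Z i ω|} ≤ ENNReal.ofReal (∫ ω, absTail x (Z 0 ω) ∂μ) := by
  have hs (i : ℕ) : MeasurableSet {z : ℝ | (truncLevel m i : ℝ) ≤ |z|} :=
    measurableSet_le measurable_const measurable_norm
  calc μ {ω | ∃ i, truncLevel m i ≤ |Z i ω|}
      ≤ ∑' i, μ (Z i ⁻¹' {z | (truncLevel m i : ℝ) ≤ |z|}) := by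
        rw [Set.ofPred_exists]
        exact measure_iUnion_le _
    _ = ∑' i, ∫⁻ ω, {z : ℝ | (truncLevel m i : ℝ) ≤ |z|}.indicator 1 (Z 0 ω) ∂μ := by
        refine tsum_congr fun i => ?_
        rw [(hident i).measure_mem_eq (hs i), ← lintegral_indicator_one (hmeas 0 (hs i))]
        rfl
    _ = ∫⁻ ω, ∑' i, {z : ℝ | (truncLevel m i : ℝ) ≤ |z|}.indicator 1 (Z 0 ω) ∂μ :=
        (lintegral_tsum fun i =>
          ((measurable_one.indicator (hs i)).comp (hmeas 0)).aemeasurable).symm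
    _ ≤ ∫⁻ ω, ENNReal.ofReal (absTail x (Z 0 ω)) ∂μ :=
        lintegral_mono fun ω => tsum_indicator_truncLevel_le_abs_le hx _
    _ = ENNReal.ofReal (∫ ω, absTail x (Z 0 ω) ∂μ) :=
        (ofReal_integral_eq_lintegral_ofReal (integrable_absTail hint x)
          (.of_forall fun _ => absTail_nonneg _ _)).symm

theorem sum_variance_truncation_div_le [IsProbabilityMeasure μ]
    (hident : ∀ i, IdentDistrib (Z i) (Z 0) μ μ) (hint : Integrable (Z 0) μ) {m : ℕ}
    (hm : 0 < m) (x : ℝ) (n : ℕ) :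
    ∑ i ∈ range n, Var[fun ω => truncation (Z i) (truncLevel m i) ω / truncLevel m i; μ]
      ≤ 2 * (x ^ 2 / m + ∫ ω, absTail x (Z 0 ω) ∂μ) := by
  have hL2 (i : ℕ) :
      MemLp (fun ω => truncation (Z 0) (truncLevel m i) ω / truncLevel m i) 2 μ := by
    simp only [div_eq_mul_inv]
    exact hint.aestronglyMeasurable.memLp_truncation.mul_const _
  have hdist (i : ℕ) : IdentDistrib (fun ω => truncation (Z i) (truncLevel m i) ω / truncLevel m i)
      (fun ω => truncation (Z 0) (truncLevel m i) ω / truncLevel m i) μ μ :=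
    (hident i).truncation.div_const _
  calc _ ≤ ∑ i ∈ range n, ∫ ω, (truncation (Z 0) (truncLevel m i) ω / truncLevel m i) ^ 2 ∂μ := by
        refine sum_le_sum fun i _ => ?_
        rw [(hdist i).variance_eq]
        exact variance_le_expectation_sq (hL2 i).aestronglyMeasurable
    _ = ∫ ω, ∑ i ∈ range n, (truncation (Z 0) (truncLevel m i) ω / truncLevel m i) ^ 2 ∂μ :=
        (integral_finsetSum _ fun i _ => (hL2 i).integrable_sq).symm
    _ ≤ ∫ ω, 2 * (x ^ 2 / m + absTail x (Z 0 ω)) ∂μ :=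
        integral_mono (integrable_finsetSum _ fun i _ => (hL2 i).integrable_sq)
          (((integrable_const _).add (integrable_absTail hint x)).const_mul _)
          fun ω => sum_sq_truncation_div_le _ hm _ _ _
    _ = 2 * (x ^ 2 / m + ∫ ω, absTail x (Z 0 ω) ∂μ) := by
        rw [integral_const_mul, integral_add (integrable_const _) (integrable_absTail hint x)]
        simp

theorem measure_exists_mul_le_sum_range_le_add (hmeas : ∀ i, Measurable (Z i))
    (hind : iIndepFun Z μ) (hident : ∀ i, IdentDistrib (Z i) (Z 0) μ μ)
    (hint : Integrable (Z 0) μ) (hmean : ∫ ω, Z 0 ω ∂μ = 0) {b : ℝ} (hb : 0 < b) {m : ℕ}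
    (hm : 0 < m) {x : ℝ} (hx : x ≤ m) (hU : ∫ ω, absTail x (Z 0 ω) ∂μ ≤ b) :
    μ {ω | ∃ k ≥ m, 3 * b * k ≤ ∑ i ∈ range k, Z i ω} ≤
      ENNReal.ofReal (2 * (x ^ 2 / m + ∫ ω, absTail x (Z 0 ω) ∂μ) / b ^ 2) +
        ENNReal.ofReal (∫ ω, absTail x (Z 0 ω) ∂μ) := by
  have : IsProbabilityMeasure μ := hind.isProbabilityMeasure
  set L : ℕ → ℝ := fun i => truncLevel m i
  have hLpos (i) : 0 < L i := Nat.cast_pos.2 (truncLevel_pos m i)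
  have hφ (i) : Measurable fun z => Set.indicator (Set.Ioc (-L i) (L i)) id z / L i :=
    (measurable_id.indicator measurableSet_Ioc).div_const _
  have hkolmogorov := measure_exists_le_abs_sum_range_sub_integral
    (f := fun i ω => truncation (Z i) (L i) ω / L i) (fun i => (hφ i).comp (hmeas i))
    (hind.comp _ hφ) (fun i => by
      simp only [div_eq_mul_inv]
      exact (hmeas i).aestronglyMeasurable.memLp_truncation.mul_const _) hb
    (sum_variance_truncation_div_le hident hint hm x)
  have hmean_le (i) : ∫ ω, truncation (Z i) (L i) ω ∂μ ≤ b := by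
    rw [(hident i).truncation.integral_eq]
    exact (integral_truncation_le hint hmean
      (hx.trans (Nat.cast_le.2 (le_max_right _ _)))).trans hU
  refine (measure_mono ?_).trans ((measure_union_le _ _).trans
    (add_le_add hkolmogorov (measure_exists_truncLevel_le_abs_le hmeas hident hint hx)))
  rintro ω ⟨k, hk, hsum⟩
  by_contra hcon
  simp only [Set.mem_union, Set.mem_ofPred_eq, not_or, not_exists, not_le] at hcon
  obtain ⟨hpartial, hsmall⟩ := hcon
  obtain ⟨n, rfl⟩ : ∃ n, k = n + 1 := ⟨k - 1, by lia⟩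
  have hLn : L n = (n + 1 : ℕ) := congrArg (Nat.cast (R := ℝ)) (max_eq_left hk)
  have hkronecker := abs_sum_range_succ_mul_lt (L := L)
    (fun _ _ h => Nat.cast_le.2 (monotone_truncLevel m h)) (hLpos 0) hpartial n
  have hterm (i) : Z i ω - b ≤ L i * (truncation (Z i) (L i) ω / L i -
      ∫ ω', truncation (Z i) (L i) ω' / L i ∂μ) := by
    rw [integral_div, ← sub_div, mul_div_cancel₀ _ (hLpos i).ne', truncation_eq_self (hsmall i)]
    exact sub_le_sub_left (hmean_le i) _
  have hlower := sum_le_sum fun i (_ : i ∈ range (n + 1)) => hterm i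
  rw [sum_sub_distrib, sum_const, card_range, nsmul_eq_mul] at hlower
  rw [hLn] at hkronecker
  linarith [(abs_lt.1 hkronecker).2]

theorem measure_exists_mul_le_sum_range_le (hmeas : ∀ i, Measurable (Z i))
    (hind : iIndepFun Z μ) (hident : ∀ i, IdentDistrib (Z i) (Z 0) μ μ)
    (hint : Integrable (Z 0) μ) (hmean : ∫ ω, Z 0 ω ∂μ = 0) {b : ℝ} (hb : 0 < b) {m : ℕ}
    (hm : 0 < m) (x : ℝ) :
    μ {ω | ∃ k ≥ m, 3 * b * k ≤ ∑ i ∈ range k, Z i ω} ≤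
      ENNReal.ofReal (3 / min (b ^ 2) 1 * (x ^ 2 / m + ∫ ω, absTail x (Z 0 ω) ∂μ)) := by
  have : IsProbabilityMeasure μ := hind.isProbabilityMeasure
  have hm1 : (1 : ℝ) ≤ m := Nat.one_le_cast.2 hm
  set U := ∫ ω, absTail x (Z 0 ω) ∂μ
  have hU0 : 0 ≤ U := integral_nonneg fun _ => absTail_nonneg _ _
  have hD0 : 0 < min (b ^ 2) 1 := by positivity
  have hT0 : 0 ≤ x ^ 2 / m := by positivity
  by_cases hcase : x ≤ m ∧ U ≤ b
  · refine (measure_exists_mul_le_sum_range_le_add hmeas hind hident hint hmean hb hm hcase.1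
      hcase.2).trans ?_
    rw [← ENNReal.ofReal_add (by positivity) hU0]
    refine ENNReal.ofReal_le_ofReal ?_
    calc 2 * (x ^ 2 / m + U) / b ^ 2 + U
        ≤ 2 * (x ^ 2 / m + U) / min (b ^ 2) 1 + (x ^ 2 / m + U) / min (b ^ 2) 1 := by
          gcongr
          · exact min_le_left _ _
          · exact (le_add_of_nonneg_left hT0).trans
              (le_div_self (by positivity) hD0 (min_le_right _ _))
      _ = 3 / min (b ^ 2) 1 * (x ^ 2 / m + U) := by ring
  · refine prob_le_one.trans (ENNReal.one_le_ofReal.2 ?_)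
    have hlarge : min (b ^ 2) 1 ≤ x ^ 2 / m + U := by
      rcases not_and_or.1 hcase with hx | hU
      · have : 1 ≤ x ^ 2 / m := by
          rw [le_div_iff₀ (by positivity)]
          nlinarith
        exact (min_le_right _ _).trans (by linarith)
      · rcases le_total b 1 with hb1 | hb1
        · exact (min_le_left _ _).trans (by nlinarith)
        · exact (min_le_right _ _).trans (by linarith)
    rw [div_mul_eq_mul_div, one_le_div hD0]
    linarith

end LargeNumbers

theorem exp_sub_sq_div_six_le (x : ℝ) : Real.exp (x - x ^ 2 / 6) ≤ 1 + x + x ^ 2 / 3 := by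
  set g : ℝ → ℝ := fun y => (1 + y + y ^ 2 / 3) * Real.exp (-y + y ^ 2 / 6) with hg
  have hderiv (y) : HasDerivAt g (y ^ 3 / 9 * Real.exp (-y + y ^ 2 / 6)) y := by
    have hpoly : HasDerivAt (fun y : ℝ => 1 + y + y ^ 2 / 3) (1 + 2 * y / 3) y := by
      simpa using ((hasDerivAt_id' y).const_add 1).fun_add ((hasDerivAt_pow 2 y).div_const 3)
    have hexponent : HasDerivAt (fun y : ℝ => -y + y ^ 2 / 6) (-1 + 2 * y / 6) y := by
      simpa using (hasDerivAt_id' y).fun_neg.fun_add ((hasDerivAt_pow 2 y).div_const 6)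
    refine (hpoly.fun_mul hexponent.exp).congr_deriv ?_
    ring
  have hcont : Continuous g := by fun_prop
  have hmin : g 0 ≤ g x := by
    rcases le_total 0 x with hx | hx
    · refine monotoneOn_of_deriv_nonneg (convex_Ici 0) hcont.continuousOn
        (fun y _ => (hderiv y).differentiableAt.differentiableWithinAt) (fun y hy => ?_)
        Set.self_mem_Ici hx hx
      have hy0 : 0 < y := by simpa using hy
      rw [(hderiv y).deriv]
      positivity
    · refine antitoneOn_of_deriv_nonpos (convex_Iic 0) hcont.continuousOn
        (fun y _ => (hderiv y).differentiableAt.differentiableWithinAt) (fun y hy => ?_)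
        hx Set.self_mem_Iic hx
      have hy0 : y < 0 := by simpa using hy
      have hcube : y ^ 3 ≤ 0 := (Odd.pow_nonpos_iff (by decide)).2 hy0.le
      rw [(hderiv y).deriv]
      exact mul_nonpos_of_nonpos_of_nonneg (by linarith) (Real.exp_pos _).le
  calc Real.exp (x - x ^ 2 / 6) ≤ Real.exp (x - x ^ 2 / 6) * g x :=
        le_mul_of_one_le_right (Real.exp_pos _).le (by simpa [hg] using hmin)
    _ = Real.exp (x - x ^ 2 / 6 + (-x + x ^ 2 / 6)) * (1 + x + x ^ 2 / 3) := by
        rw [Real.exp_add]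
        ring
    _ = 1 + x + x ^ 2 / 3 := by simp

/-- The variance proxy that normalizes the partial sums: the average of the observed and of the
unit variance with weights `1 / 3` and `2 / 3`. -/
noncomputable def selfVar {Ω : Type*} (ξ : ℕ → Ω → ℝ) (k : ℕ) (ω : Ω) : ℝ :=
  ∑ i ∈ range k, (ξ i ω ^ 2 + 2) / 3

theorem two_thirds_mul_le_selfVar {Ω : Type*} (ξ : ℕ → Ω → ℝ) (k : ℕ) (ω : Ω) :
    2 * (k : ℝ) / 3 ≤ selfVar ξ k ω := by
  calc 2 * (k : ℝ) / 3 = ∑ i ∈ range k, (2 / 3 : ℝ) := by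
        rw [sum_const, card_range, nsmul_eq_mul]
        ring
    _ ≤ selfVar ξ k ω := sum_le_sum fun i _ => by linarith [sq_nonneg (ξ i ω)]

section SelfNormalized

variable {Ω : Type*} [mΩ : MeasurableSpace Ω] {μ : Measure Ω} {Y : Ω → ℝ} {ξ : ℕ → Ω → ℝ}

theorem integrable_exp_mul_sub_sq [IsFiniteMeasure μ] (hY : Measurable Y) (θ : ℝ) :
    Integrable (fun ω => Real.exp (θ * Y ω - θ ^ 2 * ((Y ω ^ 2 + 2) / 3) / 2)) μ := by
  refine Integrable.of_bound (by fun_prop) (Real.exp (3 / 2)) (.of_forall fun ω => ?_)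
  rw [Real.norm_of_nonneg (Real.exp_pos _).le]
  refine Real.exp_le_exp.2 ?_
  nlinarith [sq_nonneg (θ * Y ω - 3), sq_nonneg θ]

theorem integral_exp_mul_sub_sq_le_one [IsProbabilityMeasure μ] (hY : Measurable Y)
    (hL2 : MemLp Y 2 μ) (hmean : ∫ ω, Y ω ∂μ = 0) (hsq : ∫ ω, Y ω ^ 2 ∂μ ≤ 1) (θ : ℝ) :
    ∫ ω, Real.exp (θ * Y ω - θ ^ 2 * ((Y ω ^ 2 + 2) / 3) / 2) ∂μ ≤ 1 := by
  have hlin : Integrable (fun ω => 1 + θ * Y ω) μ :=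
    (integrable_const _).add ((hL2.integrable one_le_two).const_mul _)
  have hquad : Integrable (fun ω => θ ^ 2 / 3 * Y ω ^ 2) μ := hL2.integrable_sq.const_mul _
  calc ∫ ω, Real.exp (θ * Y ω - θ ^ 2 * ((Y ω ^ 2 + 2) / 3) / 2) ∂μ
      ≤ ∫ ω, (1 + θ * Y ω + θ ^ 2 / 3 * Y ω ^ 2) * Real.exp (-(θ ^ 2 / 3)) ∂μ := by
        refine integral_mono (integrable_exp_mul_sub_sq hY θ) ((hlin.add hquad).mul_const _)
          fun ω => ?_
        calc Real.exp (θ * Y ω - θ ^ 2 * ((Y ω ^ 2 + 2) / 3) / 2)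
            = Real.exp (θ * Y ω - (θ * Y ω) ^ 2 / 6) * Real.exp (-(θ ^ 2 / 3)) := by
              rw [← Real.exp_add]
              ring_nf
          _ ≤ (1 + θ * Y ω + (θ * Y ω) ^ 2 / 3) * Real.exp (-(θ ^ 2 / 3)) := by
              gcongr
              exact exp_sub_sq_div_six_le _
          _ = (1 + θ * Y ω + θ ^ 2 / 3 * Y ω ^ 2) * Real.exp (-(θ ^ 2 / 3)) := by ring
    _ = (1 + θ ^ 2 / 3 * ∫ ω, Y ω ^ 2 ∂μ) * Real.exp (-(θ ^ 2 / 3)) := by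
        rw [integral_mul_const, integral_add hlin hquad, integral_add (integrable_const _)
          ((hL2.integrable one_le_two).const_mul _), integral_const_mul, integral_const_mul, hmean]
        simp
    _ ≤ Real.exp (θ ^ 2 / 3) * Real.exp (-(θ ^ 2 / 3)) := by
        gcongr
        nlinarith [Real.add_one_le_exp (θ ^ 2 / 3), sq_nonneg θ]
    _ = 1 := by rw [← Real.exp_add, add_neg_cancel, Real.exp_zero]

theorem measure_exists_log_le_mul_partialSum (hmeas : ∀ i, Measurable (ξ i))
    (hind : iIndepFun ξ μ) (hL2 : ∀ i, MemLp (ξ i) 2 μ) (hmean : ∀ i, ∫ ω, ξ i ω ∂μ = 0)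
    (hsq : ∀ i, ∫ ω, ξ i ω ^ 2 ∂μ ≤ 1) (θ : ℝ) {c : ℝ} (hc : 0 < c) :
    μ {ω | ∃ n, Real.log c ≤ θ * partialSum ξ n ω - θ ^ 2 * selfVar ξ n ω / 2}
      ≤ ENNReal.ofReal (1 / c) := by
  have : IsProbabilityMeasure μ := hind.isProbabilityMeasure
  have hφ : Measurable fun y : ℝ => Real.exp (θ * y - θ ^ 2 * ((y ^ 2 + 2) / 3) / 2) := by
    fun_prop
  refine (measure_mono ?_).trans (measure_exists_le_prod_range (fun i => hφ.comp (hmeas i))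
    (hind.comp _ fun _ => hφ) (fun i => integrable_exp_mul_sub_sq (hmeas i) θ)
    (fun i ω => (Real.exp_pos _).le)
    (fun i => integral_exp_mul_sub_sq_le_one (hmeas i) (hL2 i) (hmean i) (hsq i) θ) hc)
  rintro ω ⟨n, hn⟩
  refine ⟨n, ?_⟩
  simp only [Function.comp_apply]
  rwa [← Real.exp_sum, ← Real.log_le_iff_le_exp hc, sum_sub_distrib, ← mul_sum, ← sum_div,
    ← mul_sum]

end SelfNormalized

theorem one_le_zeta {s : ℝ} (hs : 1 < s) : 1 ≤ zeta s := by
  have hsummable : Summable fun j : ℕ => ((j : ℝ) + 1) ^ (-s) := by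
    simpa using (summable_nat_add_iff 1).2 (Real.summable_nat_rpow.2 (neg_lt_neg hs))
  simpa [zeta] using hsummable.le_tsum 0 fun j _ => by positivity

theorem sum_range_rpow_neg_one_add_le {ε x : ℝ} (hε : 0 < ε) (hx : 0 < x) (n : ℕ) :
    ∑ j ∈ range n, (x + j + 1) ^ (-(1 + ε)) ≤ x ^ (-ε) / ε := by
  have hanti : AntitoneOn (fun t : ℝ => t ^ (-(1 + ε))) (Set.Icc x (x + n)) := fun s hs t _ hst =>
    Real.rpow_le_rpow_of_nonpos (hx.trans_le hs.1) hst (by linarith)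
  calc ∑ j ∈ range n, (x + j + 1) ^ (-(1 + ε))
      ≤ ∫ t in x..x + n, t ^ (-(1 + ε)) := by
        refine le_trans (le_of_eq ?_) hanti.sum_le_integral
        push_cast
        simp only [add_assoc]
    _ = (x ^ (-ε) - (x + n) ^ (-ε)) / ε := by
        rw [integral_rpow (Or.inr ⟨by linarith, Set.notMem_uIcc_of_lt hx (by positivity)⟩),
          show -(1 + ε) + 1 = -ε by ring, div_neg, ← neg_div, neg_sub]
    _ ≤ x ^ (-ε) / ε := by
        gcongr
        exact sub_le_self _ (by positivity)

/-- The iterated logarithm `log log ((1 + ε) ^ 2 k) + ℓ_ε` under the square root of the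
boundary. -/
noncomputable def iterLog (ε : ℝ) (k : ℕ) : ℝ :=
  Real.log (Real.log ((1 + ε) ^ 2 * (k : ℝ))) + lConst ε

/-- The boundary of the law of the iterated logarithm that the partial sums are compared with. -/
noncomputable def boundary (ε : ℝ) (k : ℕ) : ℝ :=
  cConst ε * √((k : ℝ) * iterLog ε k)

/-- The level `c_j` whose reciprocal is the error probability spent on the `j`-th epoch, in which
the variance proxy lies between `w (1 + ε) ^ j` and `w (1 + ε) ^ (j + 1)`. -/
noncomputable def epochLevel (ε w : ℝ) (j : ℕ) : ℝ :=
  2 * zeta (1 + ε) * (Real.logb (1 + ε) w + j + 1) ^ (1 + ε)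

/-- The exponential parameter `θ_j` for the `j`-th epoch, which makes the line
`s = (log c_j + θ_j ^ 2 v / 2) / θ_j` tangent to `s = √(2 v log c_j)` at the geometric mean of the
end points of the epoch. -/
noncomputable def epochSlope (ε w : ℝ) (j : ℕ) : ℝ :=
  √2 * √(Real.log (epochLevel ε w j)) / (√(w * (1 + ε) ^ j) * (1 + ε) ^ (1 / 4 : ℝ))

section Stitching

variable {ε w W s : ℝ} {j k : ℕ}

theorem one_lt_epochLevel (hε : 0 < ε) (hw : 1 < w) (j : ℕ) : 1 < epochLevel ε w j := by
  have hζ := one_le_zeta (lt_add_of_pos_right 1 hε)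
  have hx : 0 < Real.logb (1 + ε) w := Real.logb_pos (by linarith) hw
  have hpow : 1 ≤ (Real.logb (1 + ε) w + j + 1) ^ (1 + ε) :=
    Real.one_le_rpow (le_add_of_nonneg_left (by positivity)) (by positivity)
  rw [epochLevel]
  nlinarith

theorem tsum_ofReal_two_div_epochLevel_le (hε : 0 < ε) (hw : 1 < w) :
    ∑' j, ENNReal.ofReal (2 / epochLevel ε w j) ≤
      ENNReal.ofReal (Real.logb (1 + ε) w ^ (-ε) / (ε * zeta (1 + ε))) := by
  have hζ : 0 < zeta (1 + ε) := zero_lt_one.trans_le (one_le_zeta (lt_add_of_pos_right 1 hε))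
  have hx : 0 < Real.logb (1 + ε) w := Real.logb_pos (by linarith) hw
  have hterm (j : ℕ) : 2 / epochLevel ε w j =
      (Real.logb (1 + ε) w + j + 1) ^ (-(1 + ε)) / zeta (1 + ε) := by
    rw [epochLevel, Real.rpow_neg (by positivity)]
    field_simp
  rw [ENNReal.tsum_eq_iSup_nat]
  refine iSup_le fun n => ?_
  simp_rw [hterm]
  rw [← ENNReal.ofReal_sum_of_nonneg fun j _ => by positivity, ← sum_div, ← div_div]
  gcongr
  exact sum_range_rpow_neg_one_add_le hε hx n

theorem log_epochLevel_le (hε : 0 < ε) (hw : 1 < w) (hj : w * (1 + ε) ^ j ≤ (1 + ε) * k) :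
    Real.log (epochLevel ε w j) ≤ (1 + ε) * iterLog ε k := by
  have hη : 1 < 1 + ε := lt_add_of_pos_right 1 hε
  have hlogη : 0 < Real.log (1 + ε) := Real.log_pos hη
  have hζ := one_le_zeta hη
  have hx : 0 < Real.logb (1 + ε) w := Real.logb_pos hη hw
  have hepoch : w * (1 + ε) ^ (j + 1) ≤ (1 + ε) ^ 2 * k := by
    rw [pow_succ]
    nlinarith
  have hindex : Real.logb (1 + ε) w + j + 1 ≤ Real.log ((1 + ε) ^ 2 * k) / Real.log (1 + ε) := by
    calc Real.logb (1 + ε) w + j + 1 = Real.logb (1 + ε) (w * (1 + ε) ^ (j + 1)) := by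
          rw [Real.logb_mul (by positivity) (by positivity), Real.logb_pow,
            Real.logb_self_eq_one hη]
          push_cast
          ring
      _ ≤ Real.logb (1 + ε) ((1 + ε) ^ 2 * k) := Real.logb_le_logb_of_le hη (by positivity) hepoch
  have hpos : 0 < Real.logb (1 + ε) w + j + 1 := by positivity
  have hloglog : Real.log (Real.logb (1 + ε) w + j + 1) ≤
      Real.log (Real.log ((1 + ε) ^ 2 * k)) - Real.log (Real.log (1 + ε)) := by
    rw [← Real.log_div ((div_pos_iff_of_pos_right hlogη).1 (hpos.trans_le hindex)).ne' hlogη.ne']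
    exact Real.log_le_log hpos hindex
  have hlogζ : 0 ≤ Real.log (2 * zeta (1 + ε)) := Real.log_nonneg (by linarith)
  rw [epochLevel, Real.log_mul (by positivity) (by positivity), Real.log_rpow hpos, iterLog,
    lConst, Real.log_div (by positivity) hlogη.ne']
  nlinarith

theorem cConst_eq (hε : 0 < ε) :
    cConst ε = (1 + ε) * (((1 + ε) ^ (1 / 4 : ℝ) + ((1 + ε) ^ (1 / 4 : ℝ))⁻¹) / √2) := by
  have hη : 0 < 1 + ε := by linarith
  rw [cConst, show (5 / 4 : ℝ) = 1 + 1 / 4 by norm_num, show (3 / 4 : ℝ) = 1 + -(1 / 4) by norm_num,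
    Real.rpow_add hη, Real.rpow_add hη, Real.rpow_one, Real.rpow_neg hη.le]
  ring

theorem le_mul_sub_of_mul_le {q u v t s : ℝ} (hq : 0 < q) (hu : 0 < u) (ht : 0 ≤ t) (huv : u ≤ v)
    (hvu : v ≤ u * q ^ 2) (hs : v * t * ((q + q⁻¹) / √2) ≤ s) :
    t ^ 2 ≤ √2 * t / (u * q) * s - (√2 * t / (u * q)) ^ 2 * v ^ 2 / 2 := by
  have hchord : 0 ≤ (v - u) * (u * q ^ 2 - v) / (u * q) ^ 2 :=
    div_nonneg (mul_nonneg (sub_nonneg.2 huv) (sub_nonneg.2 hvu)) (sq_nonneg _)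
  have hsq : (√2 * t / (u * q)) ^ 2 * v ^ 2 / 2 = t ^ 2 * (v ^ 2 / (u * q) ^ 2) := by
    rw [div_pow, mul_pow, Real.sq_sqrt zero_le_two]
    ring
  calc t ^ 2 ≤ t ^ 2 * (1 + (v - u) * (u * q ^ 2 - v) / (u * q) ^ 2) :=
        le_mul_of_one_le_right (sq_nonneg t) (le_add_of_nonneg_right hchord)
    _ = √2 * t / (u * q) * (v * t * ((q + q⁻¹) / √2)) -
          (√2 * t / (u * q)) ^ 2 * v ^ 2 / 2 := by
        rw [hsq]
        field_simp
        ring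
    _ ≤ √2 * t / (u * q) * s - (√2 * t / (u * q)) ^ 2 * v ^ 2 / 2 := by gcongr

theorem exists_log_epochLevel_le (hε : 0 < ε) (hw : 1 < w) (hwW : w ≤ W) (hWk : W ≤ (1 + ε) * k)
    (hs : boundary ε k ≤ s) :
    ∃ j, Real.log (epochLevel ε w j) ≤ epochSlope ε w j * s - epochSlope ε w j ^ 2 * W / 2 := by
  have hη : 1 < 1 + ε := lt_add_of_pos_right 1 hε
  have hW : 0 < W := by linarith
  obtain ⟨j, hj, hj'⟩ := exists_nat_pow_near ((one_le_div (zero_lt_one.trans hw)).2 hwW) hη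
  rw [le_div_iff₀' (zero_lt_one.trans hw)] at hj
  rw [div_lt_iff₀' (zero_lt_one.trans hw), pow_succ, ← mul_assoc] at hj'
  set q : ℝ := (1 + ε) ^ (1 / 4 : ℝ) with hq
  have hq4 : (q ^ 2) ^ 2 = 1 + ε := by
    rw [hq, ← pow_mul, ← Real.rpow_natCast, ← Real.rpow_mul (by positivity)]
    norm_num
  have hlog0 : 0 < Real.log (epochLevel ε w j) := Real.log_pos (one_lt_epochLevel hε hw j)
  have hlog := log_epochLevel_le hε hw (hj.trans hWk)
  have hlower : √(w * (1 + ε) ^ j) ≤ √W := Real.sqrt_le_sqrt hj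
  have hupper : √W ≤ √(w * (1 + ε) ^ j) * q ^ 2 := by
    rw [← Real.sqrt_sq (sq_nonneg q), hq4, ← Real.sqrt_mul (by positivity)]
    exact Real.sqrt_le_sqrt hj'.le
  have hroot : √W * √(Real.log (epochLevel ε w j)) ≤ (1 + ε) * √(k * iterLog ε k) := by
    rw [← Real.sqrt_mul hW.le, ← Real.sqrt_sq (zero_le_one.trans hη.le),
      ← Real.sqrt_mul (sq_nonneg _)]
    refine Real.sqrt_le_sqrt ?_
    calc W * Real.log (epochLevel ε w j) ≤ ((1 + ε) * k) * ((1 + ε) * iterLog ε k) :=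
          mul_le_mul hWk hlog hlog0.le (hW.le.trans hWk)
      _ = (1 + ε) ^ 2 * (k * iterLog ε k) := by ring
  have hbound : √W * √(Real.log (epochLevel ε w j)) * ((q + q⁻¹) / √2) ≤ s := by
    refine (mul_le_mul_of_nonneg_right hroot (by positivity)).trans (le_trans (le_of_eq ?_) hs)
    rw [boundary, cConst_eq hε]
    ring
  have htangent := le_mul_sub_of_mul_le (by positivity) (by positivity) (Real.sqrt_nonneg _)
    hlower hupper hbound
  rw [Real.sq_sqrt hlog0.le, Real.sq_sqrt hW.le] at htangent
  exact ⟨j, htangent⟩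

theorem measure_exists_boundary_le_of_ville {Ω : Type*} [MeasurableSpace Ω] {μ : Measure Ω}
    {S V : ℕ → Ω → ℝ} (hville : ∀ θ c : ℝ, 0 < c →
      μ {ω | ∃ n, Real.log c ≤ θ * S n ω - θ ^ 2 * V n ω / 2} ≤ ENNReal.ofReal (1 / c))
    (hε : 0 < ε) (hw : 1 < w) :
    μ {ω | ∃ k, w ≤ V k ω ∧ V k ω ≤ (1 + ε) * k ∧ boundary ε k ≤ |S k ω|} ≤
      ENNReal.ofReal (Real.logb (1 + ε) w ^ (-ε) / (ε * zeta (1 + ε))) := by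
  set E : ℕ → ℝ → Set Ω := fun j θ =>
    {ω | ∃ n, Real.log (epochLevel ε w j) ≤ θ * S n ω - θ ^ 2 * V n ω / 2}
  have hpos (j) : 0 < epochLevel ε w j := zero_lt_one.trans (one_lt_epochLevel hε hw j)
  have hcover : {ω | ∃ k, w ≤ V k ω ∧ V k ω ≤ (1 + ε) * k ∧ boundary ε k ≤ |S k ω|} ⊆
      ⋃ j, (E j (epochSlope ε w j) ∪ E j (-epochSlope ε w j)) := by
    rintro ω ⟨k, hwV, hVk, hS⟩
    obtain ⟨j, hj⟩ := exists_log_epochLevel_le hε hw hwV hVk hS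
    refine Set.mem_iUnion.2 ⟨j, ?_⟩
    rcases abs_choice (S k ω) with habs | habs <;> rw [habs] at hj
    · exact Or.inl ⟨k, hj⟩
    · exact Or.inr ⟨k, by rwa [neg_sq, neg_mul_comm]⟩
  calc _ ≤ ∑' j, μ (E j (epochSlope ε w j) ∪ E j (-epochSlope ε w j)) :=
        (measure_mono hcover).trans (measure_iUnion_le _)
    _ ≤ ∑' j, ENNReal.ofReal (2 / epochLevel ε w j) := by
        refine ENNReal.tsum_le_tsum fun j => (measure_union_le _ _).trans
          ((add_le_add (hville _ _ (hpos j)) (hville _ _ (hpos j))).trans (le_of_eq ?_))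
        have := hpos j
        rw [← ENNReal.ofReal_add (by positivity) (by positivity), ← add_div, one_add_one_eq_two]
    _ ≤ _ := tsum_ofReal_two_div_epochLevel_le hε hw

end Stitching

theorem cConst_pos {ε : ℝ} (hε : 0 < ε) : 0 < cConst ε := by
  unfold cConst
  positivity

theorem cConst_lt_cConst {ε' ε : ℝ} (hε' : 0 < ε') (h : ε' < ε) : cConst ε' < cConst ε := by
  unfold cConst
  gcongr

theorem iterLog_pos {ε : ℝ} (hε : 0 < ε) {k : ℕ} (hk : 1 ≤ k) : 0 < iterLog ε k := by
  have hk' : (1 : ℝ) ≤ k := by exact_mod_cast hk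
  have hlogη : 0 < Real.log (1 + ε) := Real.log_pos (lt_add_of_pos_right 1 hε)
  have hζ := one_le_zeta (lt_add_of_pos_right 1 hε)
  have hlog : 2 * Real.log (1 + ε) ≤ Real.log ((1 + ε) ^ 2 * k) := by
    rw [← Nat.cast_ofNat (R := ℝ) (n := 2), ← Real.log_pow]
    exact Real.log_le_log (by positivity) (le_mul_of_one_le_right (by positivity) hk')
  rw [iterLog, lConst, ← Real.log_mul (by linarith) (by positivity)]
  refine Real.log_pos ?_
  rw [← mul_div_assoc, lt_div_iff₀ hlogη]
  nlinarith

theorem boundary_pos {ε : ℝ} (hε : 0 < ε) {k : ℕ} (hk : 1 ≤ k) : 0 < boundary ε k :=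
  mul_pos (cConst_pos hε) (Real.sqrt_pos.2 (mul_pos (by exact_mod_cast hk) (iterLog_pos hε hk)))

theorem tendsto_iterLog_atTop {ε : ℝ} (hε : 0 < ε) :
    Tendsto (fun k => iterLog ε k) atTop atTop := by
  refine tendsto_atTop_add_const_right _ _
    (Real.tendsto_log_atTop.comp (Real.tendsto_log_atTop.comp ?_))
  exact tendsto_natCast_atTop_atTop.const_mul_atTop (by positivity)

theorem iterLog_sub_lConst_le {ε' ε : ℝ} (hε' : 0 < ε') (h : ε' ≤ ε) {k : ℕ} (hk : 1 ≤ k) :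
    iterLog ε' k - lConst ε' ≤ iterLog ε k - lConst ε := by
  have hk' : (1 : ℝ) ≤ k := by exact_mod_cast hk
  have hbase : 1 < (1 + ε') ^ 2 * (k : ℝ) := by nlinarith
  rw [iterLog, iterLog, add_sub_cancel_right, add_sub_cancel_right]
  exact Real.log_le_log (Real.log_pos hbase) (Real.log_le_log (by linarith) (by gcongr))

theorem eventually_iterLog_le_mul_iterLog {ε' ε r : ℝ} (hε' : 0 < ε') (h : ε' ≤ ε) (hr : 1 < r) :
    ∀ᶠ k in atTop, iterLog ε' k ≤ r * iterLog ε k := by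
  filter_upwards [eventually_ge_atTop 1, (tendsto_iterLog_atTop
    (hε'.trans_le h)).eventually_ge_atTop ((lConst ε' - lConst ε) / (r - 1))] with k hk hlarge
  rw [div_le_iff₀ (sub_pos.2 hr)] at hlarge
  linarith [iterLog_sub_lConst_le hε' h hk]

theorem exists_lt_one_eventually_boundary_le {ε' ε : ℝ} (hε' : 0 < ε') (h : ε' < ε) :
    ∃ δ < 1, ∀ᶠ k in atTop, boundary ε' k ≤ δ * boundary ε k := by
  obtain ⟨p, hp, hp2⟩ : ∃ p > 0, p ^ 2 = cConst ε' :=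
    ⟨_, Real.sqrt_pos.2 (cConst_pos hε'), Real.sq_sqrt (cConst_pos hε').le⟩
  obtain ⟨q, hq, hq2⟩ : ∃ q > 0, q ^ 2 = cConst ε :=
    ⟨_, Real.sqrt_pos.2 (cConst_pos (hε'.trans h)), Real.sq_sqrt (cConst_pos (hε'.trans h)).le⟩
  have hpq : p < q := by
    refine lt_of_pow_lt_pow_left₀ 2 hq.le ?_
    rw [hp2, hq2]
    exact cConst_lt_cConst hε' h
  refine ⟨p / q, (div_lt_one hq).2 hpq, ?_⟩
  have hratio : 1 < (q / p) ^ 2 := one_lt_pow₀ ((one_lt_div hp).2 hpq) two_ne_zero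
  filter_upwards [eventually_iterLog_le_mul_iterLog hε' h.le hratio] with k hk
  calc boundary ε' k ≤ p ^ 2 * √(k * ((q / p) ^ 2 * iterLog ε k)) := by
        rw [boundary, hp2]
        gcongr
        exact (cConst_pos hε').le
    _ = p / q * boundary ε k := by
        rw [mul_left_comm, Real.sqrt_mul (sq_nonneg _), Real.sqrt_sq (by positivity), boundary,
          ← hq2]
        field_simp

theorem exists_le_of_le_biSup_of_eventually_le {ι α : Type*} [CompleteLinearOrder α] {r : ι → α}
    {s : Set ι} {a d : α} (hd : d < a) (hr : ∀ᶠ k in cofinite, r k ≤ d)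
    (ha : a ≤ ⨆ k ∈ s, r k) : ∃ k ∈ s, a ≤ r k := by
  classical
  by_contra! hlt
  set F := (eventually_cofinite.1 hr).toFinset.filter (· ∈ s)
  have hF : F.sup r < a :=
    (Finset.sup_lt_iff (bot_le.trans_lt hd)).2 fun k hk => hlt k (mem_filter.1 hk).2
  refine ha.not_gt ((iSup₂_le fun k hk => ?_).trans_lt (max_lt hd hF))
  rcases le_or_gt (r k) d with hkd | hkd
  · exact hkd.trans (le_max_left _ _)
  · exact (Finset.le_sup (by simp [F, hk, hkd])).trans (le_max_right _ _)

theorem logb_rpow_neg_div_zeta_nonneg {ε w : ℝ} (hε : 0 < ε) (hw : 1 ≤ w) :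
    0 ≤ Real.logb (1 + ε) w ^ (-ε) / (ε * zeta (1 + ε)) := by
  have hη : 1 < 1 + ε := lt_add_of_pos_right 1 hε
  have hζ := one_le_zeta hη
  have hlogb := Real.logb_nonneg hη hw
  positivity

theorem partialSum_div_const {Ω : Type*} (X : ℕ → Ω → ℝ) (σ : ℝ) (k : ℕ) (ω : Ω) :
    partialSum (fun i ω => X i ω / σ) k ω = partialSum X k ω / σ :=
  (sum_div _ _ _).symm

theorem three_mul_le_sum_sq_sub_of_lt_selfVar {Ω : Type*} {X : ℕ → Ω → ℝ} {σ v ε : ℝ} {k : ℕ}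
    {ω : Ω} (hσ : 0 < σ) (hv : v ≤ σ ^ 2)
    (h : (1 + ε) * k < selfVar (fun i ω => X i ω / σ) k ω) :
    3 * (ε * σ ^ 2) * k ≤ ∑ i ∈ range k, (X i ω ^ 2 - v) := by
  have hselfVar : selfVar (fun i ω => X i ω / σ) k ω * (3 * σ ^ 2) =
      ∑ i ∈ range k, X i ω ^ 2 + k * (2 * σ ^ 2) := by
    rw [selfVar, sum_mul, ← nsmul_eq_mul, ← card_range k, ← sum_const, card_range,
      ← sum_add_distrib]
    refine sum_congr rfl fun i _ => ?_
    field_simp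
  have hkv : (k : ℝ) * v ≤ k * σ ^ 2 := by gcongr
  have hscaled := mul_lt_mul_of_pos_right h (by positivity : 0 < 3 * σ ^ 2)
  rw [sum_sub_distrib, sum_const, card_range, nsmul_eq_mul]
  linarith

section Crossing

variable {Ω : Type*} [MeasurableSpace Ω] {μ : Measure Ω}

theorem truncMoment_eq_integral_absTail (Y : Ω → ℝ) (x : ℝ) :
    truncMoment μ Y x = ∫ ω, absTail x (Y ω ^ 2 - variance Y μ) ∂μ :=
  rfl

theorem truncMoment_nonneg (Y : Ω → ℝ) (x : ℝ) : 0 ≤ truncMoment μ Y x := by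
  rw [truncMoment_eq_integral_absTail]
  exact integral_nonneg fun _ => absTail_nonneg _ _

variable {X : ℕ → Ω → ℝ} {σ ε : ℝ} {m : ℕ}

theorem measure_exists_boundary_le_abs_partialSum_of_selfVar_le {ξ : ℕ → Ω → ℝ}
    (hmeas : ∀ i, Measurable (ξ i)) (hindep : iIndepFun ξ μ) (hL2 : ∀ i, MemLp (ξ i) 2 μ)
    (hmean : ∀ i, ∫ ω, ξ i ω ∂μ = 0) (hsq : ∀ i, ∫ ω, ξ i ω ^ 2 ∂μ ≤ 1) (hε : 0 < ε)
    (hm : 2 ≤ m) :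
    μ {ω | ∃ k ≥ m, selfVar ξ k ω ≤ (1 + ε) * k ∧ boundary ε k ≤ |partialSum ξ k ω|} ≤
      ENNReal.ofReal (Real.logb (1 + ε) (2 * m / 3) ^ (-ε) / (ε * zeta (1 + ε))) := by
  have hm' : (2 : ℝ) ≤ m := by exact_mod_cast hm
  refine (measure_mono ?_).trans (measure_exists_boundary_le_of_ville
    (fun θ c hc => measure_exists_log_le_mul_partialSum hmeas hindep hL2 hmean hsq θ hc) hε
    (w := 2 * m / 3) (by linarith))
  rintro ω ⟨k, hmk, hselfVar, hS⟩
  have hmk' : (m : ℝ) ≤ k := by exact_mod_cast hmk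
  exact ⟨k, le_trans (by linarith) (two_thirds_mul_le_selfVar ξ k ω), hselfVar, hS⟩

/-- The bound on the probability that the partial sums cross the boundary after time `m`: the
error probability of stitching plus that of the law of large numbers for the squares, truncated
at level `x`. -/
noncomputable def crossingBound (μ : Measure Ω) (Y : Ω → ℝ) (σ ε x : ℝ) (m : ℕ) : ℝ :=
  Real.logb (1 + ε) (2 * m / 3) ^ (-ε) / (ε * zeta (1 + ε)) +
    3 / min (ε ^ 2 * σ ^ 4) 1 * (x ^ 2 / m + truncMoment μ Y x)

theorem measure_exists_mul_le_sum_sq_sub_variance (hmeas : ∀ i, Measurable (X i))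
    (hindep : iIndepFun X μ) (hident : ∀ i, IdentDistrib (X i) (X 0) μ μ)
    (hmean : ∫ ω, X 0 ω ∂μ = 0) (hL2 : MemLp (X 0) 2 μ) {b : ℝ} (hb : 0 < b) (hm : 0 < m)
    (x : ℝ) :
    μ {ω | ∃ k ≥ m, 3 * b * k ≤ ∑ i ∈ range k, (X i ω ^ 2 - variance (X 0) μ)} ≤
      ENNReal.ofReal (3 / min (b ^ 2) 1 * (x ^ 2 / m + truncMoment μ (X 0) x)) := by
  have : IsProbabilityMeasure μ := hindep.isProbabilityMeasure
  have hsq : Measurable fun y : ℝ => y ^ 2 - variance (X 0) μ := by fun_prop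
  rw [truncMoment_eq_integral_absTail]
  refine measure_exists_mul_le_sum_range_le (fun i => hsq.comp (hmeas i))
    (hindep.comp _ fun _ => hsq) (fun i => (hident i).comp hsq)
    (hL2.integrable_sq.sub (integrable_const _)) ?_ hb hm x
  simp only [Function.comp_apply]
  rw [integral_sub hL2.integrable_sq (integrable_const _), integral_const, probReal_univ,
    one_smul, variance_of_integral_eq_zero (hmeas 0).aemeasurable hmean, sub_self]

theorem measure_exists_boundary_le_abs_partialSum (hmeas : ∀ i, Measurable (X i))
    (hindep : iIndepFun X μ) (hident : ∀ i, IdentDistrib (X i) (X 0) μ μ)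
    (hmean : ∫ ω, X 0 ω ∂μ = 0) (hσ : 0 < σ) (hL2 : MemLp (X 0) 2 μ)
    (hvar : variance (X 0) μ ≤ σ ^ 2) (hε : 0 < ε) (hm : 2 ≤ m) (x : ℝ) :
    μ {ω | ∃ k ≥ m, boundary ε k ≤ |partialSum X k ω / σ|} ≤
      ENNReal.ofReal (crossingBound μ (X 0) σ ε x m) := by
  have : IsProbabilityMeasure μ := hindep.isProbabilityMeasure
  set ξ : ℕ → Ω → ℝ := fun i ω => X i ω / σ
  have hdiv : Measurable fun y : ℝ => y / σ := by fun_prop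
  have hξsq (i) : ∫ ω, ξ i ω ^ 2 ∂μ ≤ 1 := by
    have hsq := ((hident i).comp (measurable_id.pow_const 2)).integral_eq
    simp only [Function.comp_apply, id_eq] at hsq
    simp only [ξ, div_pow]
    rw [integral_div, div_le_one (by positivity), hsq,
      ← variance_of_integral_eq_zero (hmeas 0).aemeasurable hmean]
    exact hvar
  have hstitch := measure_exists_boundary_le_abs_partialSum_of_selfVar_le (ξ := ξ)
    (fun i => hdiv.comp (hmeas i)) (hindep.comp _ fun _ => hdiv)
    (fun i => by
      simpa only [ξ, div_eq_mul_inv] using ((hident i).memLp_iff.2 hL2).mul_const σ⁻¹)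
    (fun i => by rw [integral_div, (hident i).integral_eq, hmean, zero_div]) hξsq hε hm
  have hlln := measure_exists_mul_le_sum_sq_sub_variance hmeas hindep hident hmean hL2
    (b := ε * σ ^ 2) (by positivity) (zero_lt_two.trans_le hm) x
  have hcover : {ω | ∃ k ≥ m, boundary ε k ≤ |partialSum X k ω / σ|} ⊆
      {ω | ∃ k ≥ m, selfVar ξ k ω ≤ (1 + ε) * k ∧ boundary ε k ≤ |partialSum ξ k ω|} ∪
      {ω | ∃ k ≥ m, 3 * (ε * σ ^ 2) * k ≤ ∑ i ∈ range k, (X i ω ^ 2 - variance (X 0) μ)} := by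
    rintro ω ⟨k, hmk, hS⟩
    rcases le_or_gt (selfVar ξ k ω) ((1 + ε) * k) with hW | hW
    · exact Or.inl ⟨k, hmk, hW, by rwa [partialSum_div_const]⟩
    · exact Or.inr ⟨k, hmk, three_mul_le_sum_sq_sub_of_lt_selfVar hσ hvar hW⟩
  have hm' : (2 : ℝ) ≤ m := by exact_mod_cast hm
  have hU := truncMoment_nonneg (μ := μ) (X 0) x
  refine (measure_mono hcover).trans ((measure_union_le _ _).trans
    ((add_le_add hstitch hlln).trans (le_of_eq ?_)))
  rw [← ENNReal.ofReal_add (logb_rpow_neg_div_zeta_nonneg hε (by linarith)) (by positivity),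
    crossingBound, mul_pow, ← pow_mul]

theorem tendsto_crossingBound [IsFiniteMeasure μ] (hL2 : MemLp (X 0) 2 μ) (hε : 0 < ε)
    {x : ℕ → ℝ} (hx : Tendsto x atTop atTop)
    (hx2 : Tendsto (fun m => x m ^ 2 / m) atTop (nhds 0)) :
    Tendsto (fun m => crossingBound μ (X 0) σ ε (x m) m) atTop (nhds 0) := by
  have hscale : Tendsto (fun m : ℕ => 2 * (m : ℝ) / 3) atTop atTop :=
    (tendsto_natCast_atTop_atTop.const_mul_atTop zero_lt_two).atTop_div_const three_pos
  have hstitch : Tendsto (fun m : ℕ => Real.logb (1 + ε) (2 * m / 3) ^ (-ε)) atTop (nhds 0) :=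
    (tendsto_rpow_neg_atTop hε).comp ((Real.tendsto_logb_atTop (by linarith)).comp hscale)
  have htail : Tendsto (fun m => truncMoment μ (X 0) (x m)) atTop (nhds 0) := by
    simp_rw [truncMoment_eq_integral_absTail]
    exact (tendsto_integral_absTail (hL2.integrable_sq.sub (integrable_const _))).comp hx
  simpa only [crossingBound, zero_div, add_zero, mul_zero] using
    (hstitch.div_const (ε * zeta (1 + ε))).add
      ((hx2.add htail).const_mul (3 / min (ε ^ 2 * σ ^ 4) 1))

theorem rpow_sq_div_self {t : ℝ} (ht : 0 < t) (a : ℝ) : (t ^ a) ^ 2 / t = t ^ (2 * a - 1) := by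
  rw [Real.rpow_sub_one ht.ne', mul_comm, Real.rpow_mul ht.le, Real.rpow_two]

theorem exists_lt_one_ae_eventually_abs_partialSum_div_boundary_le (hmeas : ∀ i, Measurable (X i))
    (hindep : iIndepFun X μ) (hident : ∀ i, IdentDistrib (X i) (X 0) μ μ)
    (hmean : ∫ ω, X 0 ω ∂μ = 0) (hσ : 0 < σ) (hL2 : MemLp (X 0) 2 μ)
    (hvar : variance (X 0) μ ≤ σ ^ 2) (hε : 0 < ε) :
    ∃ δ < 1, ∀ᵐ ω ∂μ, ∀ᶠ k in atTop, |partialSum X k ω / σ| / boundary ε k ≤ δ := by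
  have : IsProbabilityMeasure μ := hindep.isProbabilityMeasure
  obtain ⟨δ, hδ, hgap⟩ :=
    exists_lt_one_eventually_boundary_le (half_pos hε) (half_lt_self hε)
  refine ⟨δ, hδ, le_antisymm (ge_of_tendsto
    (f := fun m : ℕ => ENNReal.ofReal (crossingBound μ (X 0) σ (ε / 2) ((m : ℝ) ^ (1 / 4 : ℝ)) m))
    (x := atTop) ?_ ?_) zero_le⟩
  · rw [← ENNReal.ofReal_zero]
    refine ENNReal.tendsto_ofReal (tendsto_crossingBound hL2 (half_pos hε)
      ((tendsto_rpow_atTop (by norm_num)).comp tendsto_natCast_atTop_atTop) ?_)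
    refine ((tendsto_rpow_neg_atTop one_half_pos).comp tendsto_natCast_atTop_atTop).congr' ?_
    filter_upwards [eventually_gt_atTop 0] with m hm
    rw [rpow_sq_div_self (by exact_mod_cast hm), Function.comp_apply]
    norm_num
  · filter_upwards [eventually_forall_ge_atTop.2 hgap, eventually_ge_atTop 2] with m hgap_m hm
    refine (measure_mono fun ω hω => ?_).trans (measure_exists_boundary_le_abs_partialSum hmeas
      hindep hident hmean hσ hL2 hvar (half_pos hε) hm _)
    obtain ⟨k, hmk, hk⟩ := frequently_atTop.1 (not_eventually.1 hω) m
    rw [not_le, lt_div_iff₀ (boundary_pos hε (by lia))] at hk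
    exact ⟨k, hmk, (hgap_m k hmk).trans hk.le⟩

theorem measure_one_le_iSup_abs_partialSum_div_boundary_le (hmeas : ∀ i, Measurable (X i))
    (hindep : iIndepFun X μ) (hident : ∀ i, IdentDistrib (X i) (X 0) μ μ)
    (hmean : ∫ ω, X 0 ω ∂μ = 0) (hσ : 0 < σ) (hL2 : MemLp (X 0) 2 μ)
    (hvar : variance (X 0) μ ≤ σ ^ 2) (hε : 0 < ε) (hm : 2 ≤ m) (x : ℝ) :
    μ {ω | (1 : EReal) ≤ ⨆ k, ⨆ _ : m ≤ k, ((|partialSum X k ω / σ| / boundary ε k : ℝ) : EReal)} ≤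
      ENNReal.ofReal (crossingBound μ (X 0) σ ε x m) := by
  obtain ⟨δ, hδ, hsmall⟩ := exists_lt_one_ae_eventually_abs_partialSum_div_boundary_le hmeas hindep
    hident hmean hσ hL2 hvar hε
  refine (measure_mono_ae ?_).trans (measure_exists_boundary_le_abs_partialSum hmeas hindep hident
    hmean hσ hL2 hvar hε hm x)
  filter_upwards [hsmall] with ω hω hsup
  obtain ⟨k, hmk, hk⟩ := exists_le_of_le_biSup_of_eventually_le (s := Set.Ici m)
    (EReal.coe_lt_coe_iff.2 hδ)
    (Nat.cofinite_eq_atTop ▸ hω.mono fun k hk => EReal.coe_le_coe_iff.2 hk) hsup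
  exact ⟨k, hmk, (one_le_div (boundary_pos hε (by grind))).1 (EReal.coe_le_coe_iff.1 hk)⟩

end Crossing

end LILInequality

open LILInequality in
theorem mainTheorem3_general {Ω : Type*} [MeasurableSpace Ω] (P : Measure Ω)
    (X : ℕ → Ω → ℝ) (hmeas : ∀ i, Measurable (X i)) (hindep : iIndepFun X P)
    (hident : ∀ i, IdentDistrib (X i) (X 0) P P) (hmean : ∫ ω, X 0 ω ∂P = 0)
    (σ : ℝ) (hσ : 0 < σ) (hL2 : MemLp (X 0) 2 P) (hvar : variance (X 0) P ≤ σ ^ 2)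
    (ε : ℝ) (hε : 0 < ε) (x : ℝ) (m : ℕ) (hm : 2 ≤ m) :
    P.real {ω | (1 : EReal) ≤ ⨆ k : ℕ, ⨆ _ : m ≤ k,
        ((|partialSum X k ω / σ| / (cConst ε * Real.sqrt ((k : ℝ) *
          (Real.log (Real.log ((1 + ε) ^ 2 * (k : ℝ))) + lConst ε))) : ℝ) : EReal)}
      ≤ (Real.logb (1 + ε) (2 * (m : ℝ) / 3)) ^ (-ε) / (ε * zeta (1 + ε))
        + 3 / min (ε ^ 2 * σ ^ 4) 1 * (x ^ 2 / m + truncMoment P (X 0) x) := by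
  have hm' : (2 : ℝ) ≤ m := by exact_mod_cast hm
  have hU := truncMoment_nonneg (μ := P) (X 0) x
  refine ENNReal.toReal_le_of_le_ofReal (add_nonneg
    (logb_rpow_neg_div_zeta_nonneg hε (by linarith)) (by positivity)) ?_
  exact measure_one_le_iSup_abs_partialSum_div_boundary_le hmeas hindep hident hmean hσ hL2 hvar
    hε hm x

theorem mainTheorem3 {Ω : Type*} [MeasurableSpace Ω] (P : Measure Ω) [IsProbabilityMeasure P]
    (X : ℕ → Ω → ℝ) (hmeas : ∀ i, Measurable (X i))
    (hindep : iIndepFun X P) (hident : ∀ i, IdentDistrib (X i) (X 0) P P)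
    (hint : Integrable (X 0) P) (hmean : ∫ ω, X 0 ω ∂P = 0)
    (σ : ℝ) (hσ : 0 < σ) (hL2 : MemLp (X 0) 2 P) (hvar : variance (X 0) P ≤ σ ^ 2)
    (ε : ℝ) (hε : 0 < ε) (lam : ℝ) (hlam0 : 0 < lam) (hlam1 : lam < 1 / 2)
    (m : ℕ) (hm : 2 ≤ m) :
    P.real {ω | (1 : EReal) ≤ ⨆ k : ℕ, ⨆ _ : m ≤ k,
        ((|LILInequality.partialSum X k ω / σ| /
          (LILInequality.cConst ε * Real.sqrt ((k : ℝ) *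
            (Real.log (Real.log ((1 + ε) ^ 2 * (k : ℝ))) + LILInequality.lConst ε))) : ℝ) : EReal)}
      ≤ (Real.logb (1 + ε) (2 * (m : ℝ) / 3)) ^ (-ε) / (ε * LILInequality.zeta (1 + ε))
        + 262 / min (ε ^ 2 * σ ^ 4) 1 *
          ((m : ℝ) ^ (2 * lam - 1) + LILInequality.truncMoment P (X 0) ((m : ℝ) ^ lam)) := by
  have hm0 : (0 : ℝ) < m := by exact_mod_cast zero_lt_two.trans_le hm
  have hU := LILInequality.truncMoment_nonneg (μ := P) (X 0) ((m : ℝ) ^ lam)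
  refine (mainTheorem3_general P X hmeas hindep hident hmean σ hσ hL2 hvar ε hε ((m : ℝ) ^ lam)
    m hm).trans ?_
  rw [LILInequality.rpow_sq_div_self hm0]
  gcongr
  norm_num
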